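/- Let $R$ be a commutative ring, let $D(R)$ be the (unbounded) derived category of $R$-modules, with shift functors $X\mapsto X[n]$, $n\in\mathbb{Z}$, and let $S\in D(R)$ be the complex with $R$ in degree $0$ and zero in all other degrees. Let $\operatorname{thick}\langle S\rangle$ denote the smallest class of objects of $D(R)$ that contains $S$ and is closed under shifts, retracts and distinguished triangles (if two of the three objects of a distinguished triangle belong to the class, so does the third). The following are equivalent: 1. The generating hypothesis holds in $D(R)$: if $f\colon X\to Y$ is a morphism in $D(R)$ between objects $X,Y\in\operatorname{thick}\langle S\rangle$ such that the induced map $\operatorname{Hom}_{D(R)}(S,X[n])\to\operatorname{Hom}_{D(R)}(S,Y[n])$ is zero for every $n\in\mathbb{Z}$, then $f=0$. 2. $R$ is von Neumann regular: for every $x\in R$ there exists $y\in R$ with $xyx=x$. -/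

import Mathlib

open CategoryTheory

universe w u

/-- The thick subcategory generated by `S`: the smallest class of objects containing `S` and closed
under shifts, retracts, and distinguished triangles. -/
def thickSubcategory {C : Type*} [Category* C] [Limits.HasZeroObject C] [HasShift C ℤ]
    [Preadditive C] [∀ n : ℤ, (shiftFunctor C n).Additive] [Pretriangulated C] [IsTriangulated C] (S : C) :
    ObjectProperty C :=
  (ObjectProperty.singleton S).triangEnvelope

/-- The generating hypothesis for a triangulated category `C` with distinguished object `S`: a
morphism `f : X ⟶ Y` between objects of the thick subcategory generated by `S` is zero as soon as
it induces the zero map on the graded group `Hom(S, -)_*`, that is, as soon as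
`Hom(S, X⟦n⟧) → Hom(S, Y⟦n⟧)` is zero for every integer `n`. -/
def GeneratingHypothesis {C : Type*} [Category* C] [Limits.HasZeroObject C] [HasShift C ℤ]
    [Preadditive C] [∀ n : ℤ, (shiftFunctor C n).Additive] [Pretriangulated C] [IsTriangulated C] (S : C) : Prop :=
  ∀ ⦃X Y : C⦄, thickSubcategory S X → thickSubcategory S Y → ∀ f : X ⟶ Y,
    (∀ (n : ℤ) (g : S ⟶ X⟦n⟧), g ≫ f⟦n⟧' = 0) → f = 0

/-- A ring is von Neumann regular if every `x` admits some `y` with `x * y * x = x`. -/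
def IsVonNeumannRegular (R : Type*) [Ring R] : Prop :=
  ∀ x : R, ∃ y : R, x * y * x = x

/-- The sphere object of the derived category of `R`-modules: the complex with `R` in degree `0`
and zero elsewhere. -/
noncomputable def derivedSphere (R : Type u) [CommRing R]
    [HasDerivedCategory.{w} (ModuleCat.{u} R)] : DerivedCategory (ModuleCat.{u} R) :=
  (DerivedCategory.singleFunctor (ModuleCat.{u} R) 0).obj (ModuleCat.of R R)

open Pretriangulated Limits

/-! The argument uses only that `S` has no nonzero maps to its nonzero shifts and that `End S` is
commutative. If `End S` is regular, so is every map between retracts of finite sums of shifts of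
`S`. Cones of such maps split, so these retracts exhaust the thick subcategory, and `Hom(S, -)`
detects zero maps out of them. Conversely, the hypothesis applied to the cone of `x` and then to the
fibre of `x ≫ x` makes `x` factor through `x ≫ x`. -/

section Preadditive

variable {C : Type*} [Category* C] [Preadditive C]

/-- All morphisms `f : X ⟶ Y` are von Neumann regular: `f ≫ u ≫ f = f` for some `u`. -/
def RegularHom (X Y : C) : Prop :=
  ∀ f : X ⟶ Y, ∃ u : Y ⟶ X, f ≫ u ≫ f = f

/-- A morphism `f` is von Neumann regular as soon as `f - f ≫ u ≫ f` is. -/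
lemma exists_regular_of_sub {X Y : C} (f : X ⟶ Y) (u v : Y ⟶ X)
    (h : (f - f ≫ u ≫ f) ≫ v ≫ (f - f ≫ u ≫ f) = f - f ≫ u ≫ f) :
    ∃ w : Y ⟶ X, f ≫ w ≫ f = f := by
  -- This is `u + (𝟙 - u ≫ f) ≫ v ≫ (𝟙 - f ≫ u)`, expanded.
  refine ⟨u + v - v ≫ f ≫ u - u ≫ f ≫ v + u ≫ f ≫ v ≫ f ≫ u, ?_⟩
  simp only [Preadditive.comp_sub, Preadditive.sub_comp, Preadditive.comp_add,
    Preadditive.add_comp, Category.assoc] at h ⊢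
  rw [← sub_eq_zero] at h ⊢
  rw [← h]
  abel

/-- After correcting `f` on its `X`-component, the remainder has zero `X`-component and so is
controlled by `Y` alone. -/
lemma RegularHom.to_sum {W X Y Z : C} (hX : RegularHom W X) (hY : RegularHom W Y)
    (i₁ : X ⟶ Z) (p₁ : Z ⟶ X) (i₂ : Y ⟶ Z) (p₂ : Z ⟶ Y) (h : p₁ ≫ i₁ + p₂ ≫ i₂ = 𝟙 Z) :
    RegularHom W Z := by
  intro f
  obtain ⟨u, hu⟩ := hX (f ≫ p₁)
  obtain ⟨v, hv⟩ := hY ((f - f ≫ (p₁ ≫ u) ≫ f) ≫ p₂)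
  refine exists_regular_of_sub f (p₁ ≫ u) (p₂ ≫ v) ?_
  set f' := f - f ≫ (p₁ ≫ u) ≫ f with hf'
  have h₁ : f' ≫ p₁ = 0 := by
    simp only [Category.assoc] at hu
    simp [hf', Preadditive.sub_comp, hu]
  have h₂ : f' = (f' ≫ p₂) ≫ i₂ := by
    conv_lhs => rw [← Category.comp_id f', ← h, Preadditive.comp_add, reassoc_of% h₁, zero_comp,
      zero_add, ← Category.assoc]
  have h₃ : f' ≫ (p₂ ≫ v) ≫ f' = ((f' ≫ p₂) ≫ v ≫ (f' ≫ p₂)) ≫ i₂ := by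
    simp only [Category.assoc] at h₂ ⊢
    rw [← h₂]
  rw [h₃, hv, ← h₂]

lemma RegularHom.from_sum {W X Y Z : C} (hX : RegularHom X W) (hY : RegularHom Y W)
    (i₁ : X ⟶ Z) (p₁ : Z ⟶ X) (i₂ : Y ⟶ Z) (p₂ : Z ⟶ Y) (h : p₁ ≫ i₁ + p₂ ≫ i₂ = 𝟙 Z) :
    RegularHom Z W := by
  intro f
  obtain ⟨u, hu⟩ := hX (i₁ ≫ f)
  obtain ⟨v, hv⟩ := hY (i₂ ≫ (f - f ≫ (u ≫ i₁) ≫ f))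
  refine exists_regular_of_sub f (u ≫ i₁) (v ≫ i₂) ?_
  set f' := f - f ≫ (u ≫ i₁) ≫ f with hf'
  have h₁ : i₁ ≫ f' = 0 := by
    simp only [Category.assoc] at hu
    simp [hf', Preadditive.comp_sub, hu]
  have h₂ : f' = p₂ ≫ i₂ ≫ f' := by
    conv_lhs => rw [← Category.id_comp f', ← h, Preadditive.add_comp, Category.assoc, h₁,
      comp_zero, zero_add, Category.assoc]
  have h₃ : f' ≫ (v ≫ i₂) ≫ f' = p₂ ≫ ((i₂ ≫ f') ≫ v ≫ (i₂ ≫ f')) := by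
    simp only [Category.assoc]
    conv_lhs => rw [h₂]
    simp only [Category.assoc]
    rw [← h₂]
  rw [h₃, hv, ← h₂]

/-- Retracts of finite sums of shifts of `S`; a retract of `X ⊕ Y` is given by the components
of its inclusion and of its retraction. -/
inductive IsRetractOfShiftSum [HasShift C ℤ] (S : C) : ObjectProperty C
  | shift (n : ℤ) : IsRetractOfShiftSum S (S⟦n⟧)
  | retract {X Y Z : C} (i₁ : X ⟶ Z) (p₁ : Z ⟶ X) (i₂ : Y ⟶ Z) (p₂ : Z ⟶ Y)
      (h : p₁ ≫ i₁ + p₂ ≫ i₂ = 𝟙 Z) (hX : IsRetractOfShiftSum S X)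
      (hY : IsRetractOfShiftSum S Y) : IsRetractOfShiftSum S Z

end Preadditive

/-! ### Cones, thick subcategories and the generating hypothesis -/

section Triangulated

variable {C : Type*} [Category* C] [Preadditive C] [HasShift C ℤ]

/-- If a map factors through `S`, it induces zero on `Hom(S, -)` in nonzero degrees. -/
lemma shift_comp_eq_zero_of_degree_zero {S : C} (hS : ∀ n : ℤ, n ≠ 0 → ∀ f : S ⟶ S⟦n⟧, f = 0)
    {X Y : C} (i : X ⟶ S) (j : S ⟶ Y) (h : ∀ g : S ⟶ X, g ≫ i ≫ j = 0) (n : ℤ)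
    (g : S ⟶ X⟦n⟧) : g ≫ (i ≫ j)⟦n⟧' = 0 := by
  by_cases hn : n = 0
  · subst hn
    rw [← cancel_mono ((shiftFunctorZero C ℤ).hom.app Y), zero_comp, Category.assoc,
      (shiftFunctorZero C ℤ).hom.naturality, ← Category.assoc]
    exact h _
  · rw [Functor.map_comp, ← Category.assoc, hS n hn (g ≫ i⟦n⟧'), zero_comp]

namespace IsRetractOfShiftSum

variable {S : C}

lemma of_retract {X Y : C} (r : Retract X Y) (hY : IsRetractOfShiftSum S Y) :
    IsRetractOfShiftSum S X :=
  .retract r.r r.i (0 : Y ⟶ X) 0 (by simp) hY hY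

lemma of_iso {X Y : C} (e : X ≅ Y) (hY : IsRetractOfShiftSum S Y) : IsRetractOfShiftSum S X :=
  of_retract ⟨e.hom, e.inv, by simp⟩ hY

lemma isZero {Z : C} (hZ : IsZero Z) : IsRetractOfShiftSum S Z :=
  of_retract ⟨0, 0, hZ.eq_of_src _ _⟩ (.shift 0)

variable [∀ n : ℤ, (shiftFunctor C n).Additive]

lemma shift_obj {X : C} (hX : IsRetractOfShiftSum S X) (n : ℤ) :
    IsRetractOfShiftSum S (X⟦n⟧) := by
  induction hX with
  | shift m => exact of_iso ((shiftFunctorAdd C m n).app S).symm (.shift (m + n))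
  | retract i₁ p₁ i₂ p₂ h _ _ hX hY =>
    refine .retract (i₁⟦n⟧') (p₁⟦n⟧') (i₂⟦n⟧') (p₂⟦n⟧') ?_ hX hY
    rw [← Functor.map_comp, ← Functor.map_comp, ← Functor.map_add, h]
    exact (shiftFunctor C n).map_id _

lemma regularHom_shift (hS : ∀ n : ℤ, n ≠ 0 → ∀ f : S ⟶ S⟦n⟧, f = 0) (hreg : RegularHom S S)
    (n m : ℤ) : RegularHom (S⟦n⟧) (S⟦m⟧) := by
  intro f
  by_cases hnm : m = n
  · subst hnm
    obtain ⟨f, rfl⟩ := (shiftFunctor C m).map_surjective f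
    obtain ⟨u, hu⟩ := hreg f
    exact ⟨u⟦m⟧', by rw [← Functor.map_comp, ← Functor.map_comp, hu]⟩
  · refine ⟨0, ?_⟩
    obtain ⟨k, rfl⟩ : ∃ k, m = k + n := ⟨m - n, by ring⟩
    obtain ⟨g, hg⟩ := (shiftFunctor C n).map_surjective (f ≫ (shiftFunctorAdd C k n).hom.app S)
    have hg₀ : f ≫ (shiftFunctorAdd C k n).hom.app S = 0 := by
      rw [← hg, hS k (by rintro rfl; simp at hnm) g, Functor.map_zero]
    have : f = 0 := (cancel_mono ((shiftFunctorAdd C k n).hom.app S)).1 (by simpa using hg₀)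
    simp [this]

lemma regularHom (hS : ∀ n : ℤ, n ≠ 0 → ∀ f : S ⟶ S⟦n⟧, f = 0) (hreg : RegularHom S S)
    {X Y : C} (hX : IsRetractOfShiftSum S X) (hY : IsRetractOfShiftSum S Y) :
    RegularHom X Y := by
  induction hX with
  | shift n =>
    induction hY with
    | shift m => exact regularHom_shift hS hreg n m
    | retract i₁ p₁ i₂ p₂ h _ _ hX hY => exact hX.to_sum hY i₁ p₁ i₂ p₂ h
  | retract i₁ p₁ i₂ p₂ h _ _ hX hY => exact hX.from_sum hY i₁ p₁ i₂ p₂ h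

lemma eq_zero_of_shift_comp_eq_zero {X : C} (hX : IsRetractOfShiftSum S X) {Y : C} (f : X ⟶ Y)
    (hf : ∀ (n : ℤ) (g : S ⟶ X⟦n⟧), g ≫ f⟦n⟧' = 0) : f = 0 := by
  induction hX with
  | shift n =>
    apply (shiftFunctor C (-n)).map_injective
    have e : S ≅ (S⟦n⟧)⟦-n⟧ := (shiftEquiv C n).unitIso.app S
    rw [Functor.map_zero, ← cancel_epi e.hom, comp_zero]
    exact hf (-n) _
  | retract i₁ p₁ i₂ p₂ h _ _ hX hY =>
    have h₁ : i₁ ≫ f = 0 := hX _ fun n g ↦ by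
      rw [Functor.map_comp, ← Category.assoc, hf]
    have h₂ : i₂ ≫ f = 0 := hY _ fun n g ↦ by
      rw [Functor.map_comp, ← Category.assoc, hf]
    rw [← Category.id_comp f, ← h, Preadditive.add_comp, Category.assoc, Category.assoc, h₁, h₂,
      comp_zero, comp_zero, add_zero]

variable [HasZeroObject C] [Pretriangulated C]

/-- The cone of a von Neumann regular morphism `X ⟶ Y` is a retract of `Y ⊕ X⟦1⟧`. -/
lemma cone {T : Triangle C} (hT : T ∈ distTriang C) {u : T.obj₂ ⟶ T.obj₁}
    (hu : T.mor₁ ≫ u ≫ T.mor₁ = T.mor₁) (h₁ : IsRetractOfShiftSum S T.obj₁)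
    (h₂ : IsRetractOfShiftSum S T.obj₂) : IsRetractOfShiftSum S T.obj₃ := by
  obtain ⟨s, hs⟩ := T.yoneda_exact₂ hT (𝟙 _ - u ≫ T.mor₁) (by
    rw [Preadditive.comp_sub, hu, Category.comp_id, sub_self])
  -- Since `u ≫ T.mor₁ ≫ T.mor₂ = 0`, the map `s` satisfies `T.mor₂ ≫ s ≫ T.mor₂ = T.mor₂`.
  obtain ⟨k, hk⟩ := T.yoneda_exact₃ hT (𝟙 _ - s ≫ T.mor₂) (by
    rw [Preadditive.comp_sub, ← Category.assoc, ← hs, Preadditive.sub_comp, Category.assoc,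
      comp_distTriang_mor_zero₁₂ _ hT]
    simp)
  exact .retract T.mor₂ s k T.mor₃ (by rw [← hk]; abel) h₂ (h₁.shift_obj 1)

lemma thickSubcategory_le [IsTriangulated C]
    (hS : ∀ n : ℤ, n ≠ 0 → ∀ f : S ⟶ S⟦n⟧, f = 0) (hreg : RegularHom S S) :
    thickSubcategory S ≤ IsRetractOfShiftSum S := by
  have : (IsRetractOfShiftSum S).IsStableUnderRetracts := ⟨of_retract⟩
  have : (IsRetractOfShiftSum S).IsStableUnderShift ℤ :=
    ⟨fun n ↦ ⟨fun _ hX ↦ hX.shift_obj n⟩⟩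
  have : (IsRetractOfShiftSum S).ContainsZero := ⟨_, isZero_zero C, isZero (isZero_zero C)⟩
  have : (IsRetractOfShiftSum S).IsTriangulatedClosed₃ := ⟨fun T hT h₁ h₂ ↦ by
    obtain ⟨u, hu⟩ := regularHom hS hreg h₁ h₂ T.mor₁
    exact ObjectProperty.le_isoClosure _ _ (cone hT hu h₁ h₂)⟩
  have : (IsRetractOfShiftSum S).IsTriangulatedClosed₂ := .of_isTriangulatedClosed₃
  have : (IsRetractOfShiftSum S).IsTriangulated := { }
  rw [thickSubcategory, ObjectProperty.triangEnvelope_le_iff]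
  rintro _ ⟨⟩
  exact of_iso ((shiftFunctorZero C ℤ).app S).symm (.shift 0)

end IsRetractOfShiftSum

variable [HasZeroObject C] [∀ n : ℤ, (shiftFunctor C n).Additive] [Pretriangulated C]
  [IsTriangulated C] {S : C}

theorem generatingHypothesis_of_regularHom
    (hS : ∀ n : ℤ, n ≠ 0 → ∀ f : S ⟶ S⟦n⟧, f = 0) (hreg : RegularHom S S) :
    GeneratingHypothesis S := fun _ _ hX _ f hf ↦
  (IsRetractOfShiftSum.thickSubcategory_le hS hreg _ hX).eq_zero_of_shift_comp_eq_zero f hf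

lemma thickSubcategory_self : thickSubcategory S S :=
  ObjectProperty.le_triangEnvelope _ _ ((ObjectProperty.singleton_iff S S).2 rfl)

lemma thickSubcategory_isTriangulated : (thickSubcategory S).IsTriangulated := by
  unfold thickSubcategory
  infer_instance

/-- In the cone `Z` of `x`, `b ≫ x` extends to `t : Z ⟶ S`. Every map `S ⟶ Z` factors through `g`,
so `t ≫ g` is zero on `Hom(S, -)`, hence zero. Thus `t` factors through `x`, and commutativity gives
`b ≫ x = 0`. -/
theorem GeneratingHypothesis.comp_eq_zero_of_comp_comp_eq_zero (H : GeneratingHypothesis S)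
    (hS : ∀ n : ℤ, n ≠ 0 → ∀ f : S ⟶ S⟦n⟧, f = 0)
    (hcomm : ∀ a b : S ⟶ S, a ≫ b = b ≫ a) {b x : S ⟶ S} (hb : b ≫ x ≫ x = 0) :
    b ≫ x = 0 := by
  have := thickSubcategory_isTriangulated (S := S)
  obtain ⟨Z, hZ, g, h, hT⟩ := (thickSubcategory S).distinguished_cocone_triangle x
    thickSubcategory_self thickSubcategory_self
  obtain ⟨t, ht⟩ : ∃ t : Z ⟶ S, b ≫ x = g ≫ t := Triangle.yoneda_exact₂ _ hT (b ≫ x) (by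
    change x ≫ b ≫ x = 0
    rw [hcomm x, Category.assoc, hb])
  have hxg : x ≫ g = 0 := comp_distTriang_mor_zero₁₂ _ hT
  have h₀ : t ≫ g = 0 := H hZ hZ _ (shift_comp_eq_zero_of_degree_zero hS t g fun φ ↦ by
    obtain ⟨c, rfl⟩ : ∃ c : S ⟶ S, φ = c ≫ g := Triangle.coyoneda_exact₃ _ hT φ (hS 1 one_ne_zero _)
    rw [Category.assoc, ← Category.assoc g, ← ht, Category.assoc, hxg, comp_zero, comp_zero])
  obtain ⟨s, rfl⟩ : ∃ s : Z ⟶ S, t = s ≫ x := Triangle.coyoneda_exact₂ _ hT t h₀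
  rw [ht, ← Category.assoc, hcomm, ← Category.assoc, hxg, zero_comp]

theorem GeneratingHypothesis.regularHom (H : GeneratingHypothesis S)
    (hS : ∀ n : ℤ, n ≠ 0 → ∀ f : S ⟶ S⟦n⟧, f = 0)
    (hcomm : ∀ a b : S ⟶ S, a ≫ b = b ≫ a) : RegularHom S S := by
  intro x
  have := thickSubcategory_isTriangulated (S := S)
  obtain ⟨F, hF, i, h, hT⟩ := (thickSubcategory S).distinguished_cocone_triangle₁ (x ≫ x)
    thickSubcategory_self thickSubcategory_self
  have h₀ : i ≫ x = 0 := H hF thickSubcategory_self _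
    (shift_comp_eq_zero_of_degree_zero hS i x fun φ ↦ by
      rw [← Category.assoc]
      -- Here `b` is `φ ≫ i`, which `x ≫ x` annihilates.
      refine H.comp_eq_zero_of_comp_comp_eq_zero hS hcomm ?_
      have : i ≫ x ≫ x = 0 := comp_distTriang_mor_zero₁₂ _ hT
      rw [Category.assoc, this, comp_zero])
  obtain ⟨r, hr⟩ : ∃ r : S ⟶ S, x = (x ≫ x) ≫ r := Triangle.yoneda_exact₂ _ hT x h₀
  refine ⟨r, ?_⟩
  rw [hcomm r, ← Category.assoc, ← hr]

end Triangulated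

/-! ### The sphere in the derived category -/

section DerivedCategory

variable (R : Type u) [CommRing R] [HasDerivedCategory.{w} (ModuleCat.{u} R)]

/-- `Hom(S, S⟦n⟧)` vanishes for `n ≠ 0`. -/
lemma derivedSphere_hom_shift_eq_zero (n : ℤ) (hn : n ≠ 0)
    (f : derivedSphere R ⟶ (derivedSphere R)⟦n⟧) : f = 0 := by
  rcases lt_or_gt_of_ne hn with hn | hn
  -- For `n < 0` the shift lives in cohomological degree `-n > 0`, so the t-structure gives
  -- vanishing.
  · have h₁ : DerivedCategory.IsLE (derivedSphere R) 0 := by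
      unfold derivedSphere; infer_instance
    have h₂ : DerivedCategory.IsGE (derivedSphere R) 0 := by
      unfold derivedSphere; infer_instance
    exact DerivedCategory.TStructure.t.zero_of_isLE_of_isGE f 0 (-n) (by lia) h₁
      (DerivedCategory.TStructure.t.isGE_shift (derivedSphere R) 0 n (-n))
  -- For `n > 0` this is the vanishing of positive Ext groups out of a projective.
  · have : Projective (ModuleCat.of R R) :=
      ModuleCat.projective_of_free (Module.Basis.singleton Unit R)
    let e : (derivedSphere R)⟦n⟧ ≅
        (DerivedCategory.singleFunctor (ModuleCat.{u} R) (-n)).obj (ModuleCat.of R R) :=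
      ((DerivedCategory.singleFunctors (ModuleCat.{u} R)).shiftIso n (-n) 0
        (by lia)).app (ModuleCat.of R R)
    rw [← cancel_mono e.hom, zero_comp]
    exact DerivedCategory.from_singleFunctor_obj_eq_zero_of_projective
      (L := (CochainComplex.singleFunctor (ModuleCat.{u} R) (-n)).obj (ModuleCat.of R R))
      _ (-n) (by lia)

/-- Endomorphisms of the sphere object are given by multiplication by elements of `R`. -/
noncomputable def sphereEnd (x : R) : derivedSphere R ⟶ derivedSphere R :=
  (DerivedCategory.singleFunctor (ModuleCat.{u} R) 0).map (ModuleCat.ofHom (LinearMap.mul R R x))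

lemma sphereEnd_comp (x y : R) : sphereEnd R x ≫ sphereEnd R y = sphereEnd R (y * x) := by
  unfold sphereEnd
  refine ((DerivedCategory.singleFunctor (ModuleCat.{u} R) 0).map_comp _ _).symm.trans ?_
  congr 1
  ext
  simp

lemma sphereEnd_injective : Function.Injective (sphereEnd R) := by
  intro x y h
  have h' := (DerivedCategory.singleFunctor (ModuleCat.{u} R) 0).map_injective h
  simpa using congr($(h').hom (1 : R))

lemma sphereEnd_surjective : Function.Surjective (sphereEnd R) := by
  intro f
  obtain ⟨φ, rfl⟩ := (DerivedCategory.singleFunctor (ModuleCat.{u} R) 0).map_surjective f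
  refine ⟨φ.hom (1 : R), ?_⟩
  unfold sphereEnd
  congr 1
  ext
  simp

lemma regularHom_derivedSphere_iff :
    RegularHom (derivedSphere R) (derivedSphere R) ↔ IsVonNeumannRegular R := by
  simp only [RegularHom, (sphereEnd_surjective R).forall, (sphereEnd_surjective R).exists,
    sphereEnd_comp, (sphereEnd_injective R).eq_iff, IsVonNeumannRegular]

end DerivedCategory

theorem mainTheorem2 (R : Type u) [CommRing R] [HasDerivedCategory.{w} (ModuleCat.{u} R)] :
    GeneratingHypothesis (derivedSphere R) ↔ IsVonNeumannRegular R := by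
  rw [← regularHom_derivedSphere_iff]
  refine ⟨fun H ↦ H.regularHom (derivedSphere_hom_shift_eq_zero R) ?_,
    generatingHypothesis_of_regularHom (derivedSphere_hom_shift_eq_zero R)⟩
  simp only [(sphereEnd_surjective R).forall, sphereEnd_comp]
  exact fun a b ↦ by rw [mul_comm]
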